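/- For a group $G$, the equality super commuting graph $\mathrm{ESCom}(G)$ has vertex set $G$, and two distinct vertices $g,h$ are adjacent iff $[g]=[h]$ or some $g'\in[g]$ commutes with some $h'\in[h]$, where $[\cdot]$ denotes classes for the equality relation (so $[g]=\{g\}$, and $g\neq h$ are adjacent iff $gh=hg$). Write $K_k$ for the complete graph on $k$ vertices, $\Gamma\vee\Delta$ for the join, $\Gamma\sqcup\Delta$ for the disjoint union of two graphs, and $mK_k$ for the disjoint union of $m$ copies of $K_k$. Let $Z(G)$ be the center of $G$. Consider the following (finite, non-abelian) groups: \[ \begin{aligned} D_{2n}&=\langle a,b: a^n=b^2=1,\ bab^{-1}=a^{-1}\rangle && (n\ge 3),\\ Q_{4n}&=\langle a,b: a^{2n}=1,\ a^n=b^2,\ bab^{-1}=a^{-1}\rangle && (n\ge 2),\\ QD_{2^n}&=\langle a,b: a^{2^{n-1}}=b^2=1,\ bab^{-1}=a^{2^{n-2}-1}\rangle && (n\ge 4),\\ V_{8n}&=\langle a,b: a^{2n}=b^4=1,\ ba=a^{-1}b^{-1},\ b^{-1}a=a^{-1}b\rangle && (n\ge 1),\\ SD_{8n}&=\langle a,b: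 a^{4n}=b^2=1,\ bab^{-1}=a^{2n-1}\rangle && (n\ge 2),\\ U_{6n}&=\langle a,b: a^{2n}=b^3=1,\ a^{-1}ba=b^{-1}\rangle && (n\ge 1),\\ M_{2mn}&=\langle a,b: a^m=b^{2n}=1,\ bab^{-1}=a^{-1}\rangle && (m\ge 3,\ m\ne 4,\ n\ge 1). \end{aligned} \] Then: (a) $\mathrm{ESCom}(D_{2n})\cong K_1\vee(nK_1\sqcup K_{n-1})$ if $n$ is odd, and $\mathrm{ESCom}(D_{2n})\cong K_2\vee(\tfrac n2K_2\sqcup K_{n-2})$ if $n$ is even. (b) $\mathrm{ESCom}(Q_{4n})\cong K_2\vee(nK_2\sqcup K_{2n-2})$. (c) $\mathrm{ESCom}(QD_{2^n})\cong K_2\vee(K_{2^{n-1}-2}\sqcup 2^{n-2}K_2)$. (d) $\mathrm{ESCom}(V_{8n})\cong K_2\vee(K_{4n-2}\sqcup 2nK_2)$ if $n$ is odd, and $\mathrm{ESCom}(V_{8n})\cong K_4\vee(K_{4n-4}\sqcup nK_4)$ if $n$ is even. (e) $\mathrm{ESCom}(SD_{8n})\cong K_4\vee(K_{4n-4}\sqcup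 nK_4)$ if $n$ is odd, and $\mathrm{ESCom}(SD_{8n})\cong K_2\vee(K_{4n-2}\sqcup 2nK_2)$ if $n$ is even. (f) $\mathrm{ESCom}(U_{6n})\cong K_n\vee(K_{2n}\sqcup 3K_n)$. (g) $\mathrm{ESCom}(M_{2mn})\cong K_n\vee(K_{(m-1)n}\sqcup mK_n)$ if $m$ is odd, and $\mathrm{ESCom}(M_{2mn})\cong K_{2n}\vee(K_{(\frac m2-1)2n}\sqcup\tfrac m2K_{2n})$ if $m$ is even. In every case the first factor of the join is $K_{|Z(G)|}$, i.e. its number of vertices is the order of the center of $G$. -/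

import Mathlib

/-- The `r` super commuting graph of a group `G`, for an equivalence relation `r` on `G`: two
distinct elements `g`, `h` are adjacent when `[g] = [h]`, or some `g' ∈ [g]` commutes with some
`h' ∈ [h]`. -/
def superCommutingGraph {G : Type*} [Group G] (r : Setoid G) : SimpleGraph G where
  Adj g h := g ≠ h ∧ (r g h ∨ ∃ g' h' : G, r g g' ∧ r h h' ∧ g' * h' = h' * g')
  symm := ⟨by
    rintro g h ⟨hne, hgh⟩
    refine ⟨hne.symm, ?_⟩
    rcases hgh with hr | ⟨g', h', hg, hh, hc⟩
    · exact Or.inl (r.symm hr)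
    · exact Or.inr ⟨h', g', hh, hg, hc.symm⟩⟩
  loopless := ⟨fun _ h => h.1 rfl⟩

/-- The equality super commuting graph: the equivalence relation is equality. -/
def ESCom (G : Type*) [Group G] : SimpleGraph G :=
  superCommutingGraph (⊥ : Setoid G)

/-- The join of two graphs: their disjoint union together with all edges between the two. -/
def graphJoin {V W : Type*} (G : SimpleGraph V) (H : SimpleGraph W) : SimpleGraph (V ⊕ W) :=
  (G ⊕g H) ⊔ completeBipartiteGraph V W

/-- The disjoint union of `m` copies of a graph. -/
def graphCopies {V : Type*} (m : ℕ) (G : SimpleGraph V) : SimpleGraph (Fin m × V) where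
  Adj x y := x.1 = y.1 ∧ G.Adj x.2 y.2
  symm := ⟨fun _ _ h => ⟨h.1.symm, h.2.symm⟩⟩
  loopless := ⟨fun _ h => G.loopless.irrefl _ h.2⟩

/-- The complete graph `K_n` on `n` vertices. -/
abbrev completeGr (n : ℕ) : SimpleGraph (Fin n) := ⊤

/-- The first free generator, written `a` in the presentations below. -/
abbrev genA : FreeGroup (Fin 2) := FreeGroup.of 0

/-- The second free generator, written `b` in the presentations below. -/
abbrev genB : FreeGroup (Fin 2) := FreeGroup.of 1

/-- `QD_{2^n} = ⟨a, b : a^(2^(n-1)) = b^2 = 1, b a b⁻¹ = a^(2^(n-2)-1)⟩`, used for `n ≥ 4`.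
Here and below an equation `u = v` is encoded by the relator `u * v⁻¹`. -/
abbrev QuasidihedralGrp (n : ℕ) : Type :=
  PresentedGroup ({genA ^ 2 ^ (n - 1), genB ^ 2,
    (genB * genA * genB⁻¹) * (genA ^ (2 ^ (n - 2) - 1))⁻¹} : Set (FreeGroup (Fin 2)))

/-- `V_{8n} = ⟨a, b : a^(2n) = b^4 = 1, b a = a⁻¹ b⁻¹, b⁻¹ a = a⁻¹ b⟩`. -/
abbrev VGrp (n : ℕ) : Type :=
  PresentedGroup ({genA ^ (2 * n), genB ^ 4, (genB * genA) * (genA⁻¹ * genB⁻¹)⁻¹,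
    (genB⁻¹ * genA) * (genA⁻¹ * genB)⁻¹} : Set (FreeGroup (Fin 2)))

/-- `SD_{8n} = ⟨a, b : a^(4n) = b^2 = 1, b a b⁻¹ = a^(2n-1)⟩`, used for `n ≥ 2`. -/
abbrev SemidihedralGrp (n : ℕ) : Type :=
  PresentedGroup ({genA ^ (4 * n), genB ^ 2,
    (genB * genA * genB⁻¹) * (genA ^ (2 * n - 1))⁻¹} : Set (FreeGroup (Fin 2)))

/-- `U_{6n} = ⟨a, b : a^(2n) = b^3 = 1, a⁻¹ b a = b⁻¹⟩`. -/
abbrev UGrp (n : ℕ) : Type :=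
  PresentedGroup ({genA ^ (2 * n), genB ^ 3,
    (genA⁻¹ * genB * genA) * (genB⁻¹)⁻¹} : Set (FreeGroup (Fin 2)))

/-- `M_{2mn} = ⟨a, b : a^m = b^(2n) = 1, b a b⁻¹ = a⁻¹⟩`. -/
abbrev MGrp (m n : ℕ) : Type :=
  PresentedGroup ({genA ^ m, genB ^ (2 * n),
    (genB * genA * genB⁻¹) * (genA⁻¹)⁻¹} : Set (FreeGroup (Fin 2)))

/-! Each of these groups has an abelian subgroup `A` of index two. An element `t` outside `A` acts
on `A` by an involution `σ`, and `z = t²` is a point of `A` fixed by `σ`. Let `F` be the subgroup of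
`σ`-fixed points. Elements of `A` commute with each other; `x ∈ A` commutes with `y t` iff `x ∈ F`;
and `x t`, `y t` commute iff `y - x ∈ F`. So, with `k = |F|`, the elements of `F` are joined to
everything, `A \ F` is a clique, and the other coset splits into `|A| / k` cliques of size `k`, one
for each coset of `F`. This is `TwoExt.nonempty_iso`. If `σ` is nontrivial, then `F` is the centre.
Only `A` and `|F|` remain to be found.

A presented group is identified with its extension by a pair of mutually inverse homomorphisms
(`TwoExt.nonempty_mulEquiv`). For all families but `V_{8n}`, `A` is `ZMod p × ZMod q` and `σ`
multiplies the factors by integers `r` and `s`, so `|F| = gcd(p, r - 1) * gcd(q, s - 1)`. For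
`V_{8n}`, `σ` mixes the factors and `F` is counted directly. -/

/-- An involution of an abelian group together with a fixed point: the data of a group extension
of a group of order two by the abelian group. -/
structure TwistDatum (A : Type*) [AddCommGroup A] where
  /-- The involution. -/
  twist : A →+ A
  /-- The square of the adjoined element. -/
  square : A
  twist_twist : ∀ x, twist (twist x) = x
  twist_square : twist square = square

/-- The extension of a group of order two by `A`: it is generated by a copy `even` of `A` and an
element `odd 0`, which acts on `A` as the involution and squares to the given fixed point. -/
inductive TwoExt {A : Type*} [AddCommGroup A] (D : TwistDatum A) : Type _
  | even : A → TwoExt D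
  | odd : A → TwoExt D

/-! ### Extensions of a group of order two by an abelian group -/

namespace TwoExt

variable {A : Type*} [AddCommGroup A] {D : TwistDatum A}

/-- With `t = odd 0`, `odd x` stands for `x t`; the table is forced by `t y = σ(y) t` and `t² = z`.
-/
instance : Mul (TwoExt D) where
  mul
    | even x, even y => even (x + y)
    | even x, odd y => odd (x + y)
    | odd x, even y => odd (x + D.twist y)
    | odd x, odd y => even (x + D.twist y + D.square)

instance : One (TwoExt D) := ⟨even 0⟩

instance : Inv (TwoExt D) where
  inv
    | even x => even (-x)
    | odd x => odd (-D.twist x - D.square)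

@[simp] theorem even_mul_even (x y : A) : (even x * even y : TwoExt D) = even (x + y) := rfl
@[simp] theorem even_mul_odd (x y : A) : (even x * odd y : TwoExt D) = odd (x + y) := rfl
@[simp] theorem odd_mul_even (x y : A) :
    (odd x * even y : TwoExt D) = odd (x + D.twist y) := rfl
@[simp] theorem odd_mul_odd (x y : A) :
    (odd x * odd y : TwoExt D) = even (x + D.twist y + D.square) := rfl
theorem one_def : (1 : TwoExt D) = even 0 := rfl
@[simp] theorem inv_even (x : A) : (even x : TwoExt D)⁻¹ = even (-x) := rfl
@[simp] theorem inv_odd (x : A) : (odd x : TwoExt D)⁻¹ = odd (-D.twist x - D.square) := rfl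

/-- Associativity on three odd elements is where both `σ² = 1` and `σ z = z` are needed. -/
instance : Group (TwoExt D) := Group.ofLeftAxioms
  (by
    rintro (x | x) (y | y) (w | w) <;>
      simp [D.twist_twist, D.twist_square] <;> abel)
  (by rintro (x | x) <;> simp [one_def])
  (by rintro (x | x) <;> simp [one_def, sub_eq_add_neg, add_assoc])

theorem even_pow (x : A) (n : ℕ) : (even x : TwoExt D) ^ n = even (n • x) := by
  induction n with
  | zero => simp [one_def]
  | succ n ih => rw [pow_succ, ih, even_mul_even, succ_nsmul]

theorem even_zpow (x : A) (n : ℤ) : (even x : TwoExt D) ^ n = even (n • x) := by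
  cases n with
  | ofNat n => simp [even_pow]
  | negSucc n => simp [even_pow, zpow_negSucc, negSucc_zsmul]

variable (D) in
/-- The subgroup of `A` of the elements fixed by the involution. -/
def fixed : AddSubgroup A where
  carrier := {x | D.twist x = x}
  zero_mem' := map_zero _
  add_mem' := by
    intro x y hx hy
    simp_all
  neg_mem' := by
    intro x hx
    simp_all

@[simp] theorem mem_fixed {x : A} : x ∈ fixed D ↔ D.twist x = x := Iff.rfl

theorem commute_even_odd {x y : A} :
    (even x * odd y : TwoExt D) = odd y * even x ↔ x ∈ fixed D := by
  simp only [even_mul_odd, odd_mul_even, odd.injEq, mem_fixed, add_comm x y, add_right_inj]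
  exact eq_comm

theorem commute_odd_odd {x y : A} :
    (odd x * odd y : TwoExt D) = odd y * odd x ↔ -x + y ∈ fixed D := by
  simp only [odd_mul_odd, even.injEq, mem_fixed, add_left_inj, map_add, map_neg]
  constructor <;> intro h
  · rw [neg_add_eq_iff_eq_add, ← add_assoc, add_comm (D.twist x), add_assoc, eq_neg_add_iff_add_eq, h,
      add_comm y]
  · rw [neg_add_eq_iff_eq_add, ← add_assoc, add_comm (D.twist x), add_assoc, eq_neg_add_iff_add_eq] at h
    rw [h, add_comm y]

/-- A central odd element would commute with all of `A`, forcing every element of `A` to be fixed.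
-/
theorem mem_center_iff (h : fixed D ≠ ⊤) {g : TwoExt D} :
    g ∈ Subgroup.center (TwoExt D) ↔ ∃ x ∈ fixed D, even x = g := by
  rw [Subgroup.mem_center_iff]
  constructor
  · intro hg
    cases g with
    | even x => exact ⟨x, commute_even_odd.1 (hg (odd 0)).symm, rfl⟩
    | odd y => exact absurd ((AddSubgroup.eq_top_iff' _).2 fun x =>
        commute_even_odd.1 (hg (even x))) h
  · rintro ⟨x, hx, rfl⟩ (y | y)
    · simp [add_comm]
    · exact (commute_even_odd.2 hx).symm

theorem card_center (h : fixed D ≠ ⊤) :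
    Nat.card (Subgroup.center (TwoExt D)) = Nat.card (fixed D) := by
  refine (Nat.card_congr (Equiv.ofBijective
    (fun x : fixed D => (⟨even x, (mem_center_iff h).2 ⟨x, x.2, rfl⟩⟩ :
      Subgroup.center (TwoExt D))) ⟨?_, ?_⟩)).symm
  · intro x y hxy
    simpa using hxy
  · rintro ⟨g, hg⟩
    obtain ⟨x, hx, rfl⟩ := (mem_center_iff h).1 hg
    exact ⟨⟨x, hx⟩, rfl⟩

end TwoExt

/-! ### The commuting graph of an extension -/

theorem ESCom_adj {G : Type*} [Group G] {g h : G} :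
    (ESCom G).Adj g h ↔ g ≠ h ∧ g * h = h * g := by
  change g ≠ h ∧ (g = h ∨ ∃ g' h' : G, g = g' ∧ h = h' ∧ g' * h' = h' * g') ↔ _
  constructor
  · rintro ⟨hne, heq | ⟨_, _, rfl, rfl, hc⟩⟩
    · exact absurd heq hne
    · exact ⟨hne, hc⟩
  · rintro ⟨hne, hc⟩
    exact ⟨hne, Or.inr ⟨g, h, rfl, rfl, hc⟩⟩

/-- Isomorphic groups have isomorphic equality super commuting graphs. -/
def ESComCongr {G H : Type*} [Group G] [Group H] (e : G ≃* H) : ESCom G ≃g ESCom H where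
  toEquiv := e.toEquiv
  map_rel_iff' := by
    intro g h
    simp [ESCom_adj, ← map_mul]

/-- Isomorphic graphs have isomorphic joins. -/
def graphJoinCongr {V V' W W' : Type*} {G : SimpleGraph V} {G' : SimpleGraph V'}
    {H : SimpleGraph W} {H' : SimpleGraph W'} (e : G ≃g G') (f : H ≃g H') :
    graphJoin G H ≃g graphJoin G' H' where
  toEquiv := Equiv.sumCongr e.toEquiv f.toEquiv
  map_rel_iff' := by
    rintro (x | x) (y | y) <;> simp [graphJoin, e.map_adj_iff, f.map_adj_iff]

namespace TwoExt

variable {A : Type*} [AddCommGroup A] {D : TwistDatum A}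

open Classical in
/-- The elements of the extension, sorted into the centre, the rest of the abelian subgroup, and
the other coset. -/
noncomputable def splitEquiv (D : TwistDatum A) :
    fixed D ⊕ ({x : A // x ∉ fixed D} ⊕ (A ⧸ fixed D) × fixed D) ≃ TwoExt D :=
  (Equiv.sumAssoc _ _ _).symm.trans <|
    (Equiv.sumCongr (Equiv.sumCompl (· ∈ fixed D))
      (AddSubgroup.addGroupEquivQuotientProdAddSubgroup (s := fixed D)).symm).trans
    { toFun := Sum.elim even odd
      invFun := fun g => match g with
        | even x => Sum.inl x
        | odd x => Sum.inr x
      left_inv := by rintro (x | x) <;> rfl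
      right_inv := by rintro (x | x) <;> rfl }

theorem splitEquiv_inl (x : fixed D) : splitEquiv D (Sum.inl x) = even (x : A) := rfl

theorem splitEquiv_inr_inl (x : {x : A // x ∉ fixed D}) :
    splitEquiv D (Sum.inr (Sum.inl x)) = even (x : A) := rfl

/-- The bijection depends on a choice of coset representatives, but adjacency of odd elements sees
only the coset, which is the first coordinate. -/
theorem exists_splitEquiv_inr_inr (p : (A ⧸ fixed D) × fixed D) :
    ∃ x : A, splitEquiv D (Sum.inr (Sum.inr p)) = odd x ∧ (x : A ⧸ fixed D) = p.1 := by
  refine ⟨_, rfl, ?_⟩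
  have := (AddSubgroup.addGroupEquivQuotientProdAddSubgroup (s := fixed D)).apply_symm_apply p
  exact congrArg Prod.fst this

theorem nonempty_iso [Finite A] {k d c : ℕ} (hk : Nat.card (fixed D) = k)
    (hd : d + k = Nat.card A) (hc : c * k = Nat.card A) :
    Nonempty (ESCom (TwoExt D) ≃g
      graphJoin (completeGr k) (completeGr d ⊕g graphCopies c (completeGr k))) := by
  classical
  have hk0 : 0 < k := hk ▸ Nat.card_pos
  have hd' : Nat.card {x : A // x ∉ fixed D} = d := by
    have h := Nat.card_congr (Equiv.sumCompl (· ∈ fixed D))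
    rw [Nat.card_sum] at h
    change Nat.card (fixed D) + _ = _ at h
    omega
  have hc' : Nat.card (A ⧸ fixed D) = c := by
    have h := (fixed D).card_eq_card_quotient_mul_card_addSubgroup
    rw [hk, ← hc] at h
    exact (Nat.eq_of_mul_eq_mul_right hk0 h).symm
  let ek := Finite.equivFinOfCardEq hk
  let ed := Finite.equivFinOfCardEq hd'
  let ec := Finite.equivFinOfCardEq hc'
  let e := Equiv.sumCongr ek (Equiv.sumCongr ed (Equiv.prodCongr ec ek))
  refine ⟨⟨(splitEquiv D).symm.trans e, ?_⟩⟩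
  intro g h
  obtain ⟨g, rfl⟩ := (splitEquiv D).surjective g
  obtain ⟨h, rfl⟩ := (splitEquiv D).surjective h
  simp only [Equiv.trans_apply, Equiv.symm_apply_apply, ESCom_adj, ne_eq,
    EmbeddingLike.apply_eq_iff_eq]
  rcases g with x | x | p <;> rcases h with y | y | q
  · simp [e, graphJoin, splitEquiv_inl, add_comm]
  · simp [e, graphJoin, splitEquiv_inl, splitEquiv_inr_inl, add_comm]
  · obtain ⟨w, hw, -⟩ := exists_splitEquiv_inr_inr q
    simp only [hw, splitEquiv_inl, commute_even_odd]
    simp [e, graphJoin]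
  · simp [e, graphJoin, splitEquiv_inl, splitEquiv_inr_inl, add_comm]
  · simp [e, graphJoin, splitEquiv_inr_inl, add_comm]
  · obtain ⟨w, hw, -⟩ := exists_splitEquiv_inr_inr q
    simp only [hw, splitEquiv_inr_inl, commute_even_odd]
    simpa [e, graphJoin] using x.2
  · obtain ⟨w, hw, -⟩ := exists_splitEquiv_inr_inr p
    rw [eq_comm (a := splitEquiv D _ * _)]
    simp only [hw, splitEquiv_inl, commute_even_odd]
    simp [e, graphJoin]
  · obtain ⟨w, hw, -⟩ := exists_splitEquiv_inr_inr p
    rw [eq_comm (a := splitEquiv D _ * _)]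
    simp only [hw, splitEquiv_inr_inl, commute_even_odd]
    simpa [e, graphJoin] using y.2
  · obtain ⟨v, hv, hv'⟩ := exists_splitEquiv_inr_inr p
    obtain ⟨w, hw, hw'⟩ := exists_splitEquiv_inr_inr q
    -- Commuting now reads as equality of cosets of `F`, that is, lying in the same copy of `K_k`.
    simp only [hv, hw, commute_odd_odd, ← QuotientAddGroup.eq, hv', hw']
    rcases p with ⟨p, p'⟩
    rcases q with ⟨q, q'⟩
    simp [e, graphJoin, graphCopies]
    tauto

end TwoExt

/-! ### Recognising a presented group as an extension -/

/-- The homomorphism from a product of two cyclic groups given by two commuting elements. -/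
def zmodProdHom {P : Type*} [Group P] {p q : ℕ} (u v : P) (hu : u ^ p = 1) (hv : v ^ q = 1)
    (h : Commute u v) : ZMod p × ZMod q →+ Additive P :=
  AddMonoidHom.noncommCoprod
    (ZMod.lift p ⟨zmultiplesHom (Additive P) (Additive.ofMul u), by
      simp [← ofMul_pow, hu]⟩)
    (ZMod.lift q ⟨zmultiplesHom (Additive P) (Additive.ofMul v), by
      simp [← ofMul_pow, hv]⟩) (by
    intro i j
    obtain ⟨i, rfl⟩ := ZMod.intCast_surjective i
    obtain ⟨j, rfl⟩ := ZMod.intCast_surjective j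
    rw [ZMod.lift_coe, ZMod.lift_coe]
    exact h.zpow_zpow i j)

theorem zmodProdHom_intCast {P : Type*} [Group P] {p q : ℕ} {u v : P} (hu : u ^ p = 1)
    (hv : v ^ q = 1) (h : Commute u v) (i j : ℤ) :
    (zmodProdHom u v hu hv h ((i : ZMod p), (j : ZMod q))).toMul = u ^ i * v ^ j := by
  simp only [zmodProdHom, AddMonoidHom.noncommCoprod_apply, ZMod.lift_coe]
  rfl

namespace TwoExt

/-- The homomorphism out of an extension given by its values on the abelian subgroup and on the
adjoined element. -/
def lift {A : Type*} [AddCommGroup A] {D : TwistDatum A} {P : Type*} [Group P]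
    (f : A →+ Additive P) (t : P)
    (ht : ∀ x, t * (f x).toMul = (f (D.twist x)).toMul * t) (hz : t * t = (f D.square).toMul) :
    TwoExt D →* P where
  toFun g := match g with
    | even x => (f x).toMul
    | odd x => (f x).toMul * t
  map_one' := by simp
  map_mul' := by
    rintro (x | x) (y | y)
    · simp
    · simp [mul_assoc]
    · simp [mul_assoc, ht]
    · simp only [map_add, toMul_add, ← hz]
      simp only [mul_assoc]
      rw [← mul_assoc t, ht, mul_assoc]

/-- The presentation supplies `f`; the relations in `P` supply a homomorphism `g` back. They compose
to the identity on generators of `P`, so `f` is injective, and the images of `u`, `v`, `t` generate,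
so it is surjective. The order of `P` is never computed. The integers are the matrix of `σ` and the
coordinates of `z`, shared by both sides. -/
theorem nonempty_mulEquiv {p q : ℕ} {D : TwistDatum (ZMod p × ZMod q)} {P : Type*} [Group P]
    (f : P →* TwoExt D) {u v t : P} (hcl : Subgroup.closure {u, v, t} = ⊤)
    (hfu : f u = even (1, 0)) (hfv : f v = even (0, 1)) (hft : f t = odd 0)
    (hu : u ^ p = 1) (hv : v ^ q = 1) (h : Commute u v) (a b c d e s : ℤ)
    (hDu : D.twist (1, 0) = ((a : ZMod p), (b : ZMod q)))
    (hDv : D.twist (0, 1) = ((c : ZMod p), (d : ZMod q)))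
    (hDs : D.square = ((e : ZMod p), (s : ZMod q)))
    (htu : t * u = u ^ a * v ^ b * t) (htv : t * v = u ^ c * v ^ d * t)
    (hts : t * t = u ^ e * v ^ s) : Nonempty (P ≃* TwoExt D) := by
  have hpair : ∀ i j : ℤ, ((i : ZMod p), (j : ZMod q)) = i • (1, 0) + j • (0, 1) := by
    intro i j
    simp
  have hφ := zmodProdHom_intCast hu hv h
  -- Conjugation by `t` and `σ` are both homomorphisms, so it is enough to compare them on `u` and
  -- `v`.
  have key : ∀ x, t * (zmodProdHom u v hu hv h x).toMul =
      (zmodProdHom u v hu hv h (D.twist x)).toMul * t := by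
    have hu' : t * u * t⁻¹ = u ^ a * v ^ b := by rw [htu, mul_inv_cancel_right]
    have hv' : t * v * t⁻¹ = u ^ c * v ^ d := by rw [htv, mul_inv_cancel_right]
    rintro ⟨i, j⟩
    obtain ⟨i, rfl⟩ := ZMod.intCast_surjective i
    obtain ⟨j, rfl⟩ := ZMod.intCast_surjective j
    rw [← mul_inv_eq_iff_eq_mul, hφ, ← conj_mul, ← conj_zpow, ← conj_zpow, hu', hv', hpair,
      map_add, map_zsmul, map_zsmul, hDu, hDv, map_add, map_zsmul, map_zsmul, ← hφ, ← hφ]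
    rfl
  let g := lift (zmodProdHom u v hu hv h) t key (by rw [hts, hDs, hφ])
  have hgu : g (even (1, 0)) = u := by
    change (zmodProdHom u v hu hv h (1, 0)).toMul = u
    simpa using hφ 1 0
  have hgv : g (even (0, 1)) = v := by
    change (zmodProdHom u v hu hv h (0, 1)).toMul = v
    simpa using hφ 0 1
  have hgt : g (odd 0) = t := by simp [g, lift]
  have hgf : g.comp f = MonoidHom.id P := by
    refine MonoidHom.eq_of_eqOn_dense hcl ?_
    rintro x (rfl | rfl | rfl)
    · simp [hfu, hgu]
    · simp [hfv, hgv]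
    · simp [hft, hgt]
  have hsurj : Function.Surjective f := by
    have hev : ∀ x, ∃ y, f y = even x := by
      rintro ⟨i, j⟩
      obtain ⟨i, rfl⟩ := ZMod.intCast_surjective i
      obtain ⟨j, rfl⟩ := ZMod.intCast_surjective j
      exact ⟨u ^ i * v ^ j, by rw [map_mul, map_zpow, map_zpow, hfu, hfv, even_zpow, even_zpow,
        even_mul_even, hpair]⟩
    rintro (x | x)
    · exact hev x
    · obtain ⟨y, hy⟩ := hev x
      exact ⟨y * t, by rw [map_mul, hy, hft, even_mul_odd, add_zero]⟩
  exact ⟨MulEquiv.ofBijective f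
    ⟨Function.LeftInverse.injective (g := g) (DFunLike.congr_fun hgf), hsurj⟩⟩

theorem nonempty_iso_of_mulEquiv {A : Type*} [AddCommGroup A] [Finite A] {D : TwistDatum A}
    {P : Type*} [Group P] (e : Nonempty (P ≃* TwoExt D)) {k d c : ℕ}
    (hk : Nat.card (fixed D) = k) (hd : d + k = Nat.card A) (hd0 : d ≠ 0)
    (hc : c * k = Nat.card A) :
    Nat.card (Subgroup.center P) = k ∧ Nonempty (ESCom P ≃g
      graphJoin (completeGr k) (completeGr d ⊕g graphCopies c (completeGr k))) := by
  obtain ⟨e⟩ := e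
  obtain ⟨i⟩ := nonempty_iso hk hd hc
  refine ⟨?_, ⟨(ESComCongr e).trans i⟩⟩
  rw [Nat.card_congr (Subgroup.centerCongr e).toEquiv, card_center, hk]
  -- If every point were fixed, then `k = |A|` and `d = 0`.
  intro h
  rw [h, AddSubgroup.card_top] at hk
  omega

end TwoExt

/-! ### Diagonal involutions and their fixed points -/

theorem ZMod.card_mul_eq_zero (N d : ℕ) [NeZero N] :
    Nat.card {i : ZMod N // (d : ZMod N) * i = 0} = N.gcd d := by
  have h := IsAddCyclic.card_nsmulAddMonoidHom_ker (G := ZMod N) d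
  rw [Nat.card_zmod] at h
  rw [← h]
  exact Nat.card_congr (Equiv.subtypeEquivRight fun i => by
    simp [AddMonoidHom.mem_ker, nsmul_eq_mul])

/-- The condition is `(r - 1) i = 0`, and the sign of `r - 1` does not affect the kernel. -/
theorem ZMod.card_intCast_mul_eq_self (N : ℕ) [NeZero N] (r : ℤ) :
    Nat.card {i : ZMod N // (r : ZMod N) * i = i} = N.gcd (r - 1).natAbs := by
  rw [← ZMod.card_mul_eq_zero]
  refine Nat.card_congr (Equiv.subtypeEquivRight fun i => ?_)
  have h : (r : ZMod N) * i = i ↔ ((r - 1 : ℤ) : ZMod N) * i = 0 := by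
    push_cast
    rw [sub_mul, one_mul, sub_eq_zero]
  rw [h, ← Int.cast_natCast]
  rcases Int.natAbs_eq (r - 1) with h' | h'
  · rw [← h']
  · rw [h']
    simp

/-- The involution of a product of two cyclic groups that multiplies by an integer on each
factor. -/
def diagDatum (p q : ℕ) (r s : ℤ) (z : ZMod p × ZMod q) (hr : (r * r : ZMod p) = 1)
    (hs : (s * s : ZMod q) = 1) (hz1 : r * z.1 = z.1) (hz2 : s * z.2 = z.2) :
    TwistDatum (ZMod p × ZMod q) where
  twist := AddMonoidHom.prodMap (AddMonoidHom.mulLeft (r : ZMod p))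
    (AddMonoidHom.mulLeft (s : ZMod q))
  square := z
  twist_twist := by
    rintro ⟨i, j⟩
    simp [← mul_assoc, hr, hs]
  twist_square := Prod.ext hz1 hz2

theorem diagDatum_twist {p q : ℕ} {r s : ℤ} {z : ZMod p × ZMod q} {hr hs hz1 hz2}
    (x : ZMod p × ZMod q) :
    (diagDatum p q r s z hr hs hz1 hz2).twist x = (r * x.1, s * x.2) := rfl

theorem diagDatum_square {p q : ℕ} {r s : ℤ} {z : ZMod p × ZMod q} {hr hs hz1 hz2} :
    (diagDatum p q r s z hr hs hz1 hz2).square = z := rfl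

theorem card_fixed_diagDatum {p q : ℕ} [NeZero p] [NeZero q] {r s : ℤ} {z : ZMod p × ZMod q}
    {hr hs hz1 hz2} :
    Nat.card (TwoExt.fixed (diagDatum p q r s z hr hs hz1 hz2)) =
      p.gcd (r - 1).natAbs * q.gcd (s - 1).natAbs := by
  rw [← ZMod.card_intCast_mul_eq_self, ← ZMod.card_intCast_mul_eq_self, ← Nat.card_prod]
  refine Nat.card_congr ((Equiv.subtypeEquivRight fun x => ?_).trans Equiv.subtypeProdEquivProd)
  rw [TwoExt.mem_fixed, diagDatum_twist, Prod.ext_iff]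

theorem nonempty_iso_diagDatum {p q : ℕ} [NeZero p] [NeZero q] {r s : ℤ} {z : ZMod p × ZMod q}
    {hr hs hz1 hz2} {P : Type*} [Group P]
    (e : Nonempty (P ≃* TwoExt (diagDatum p q r s z hr hs hz1 hz2))) {k d c : ℕ}
    (hk : p.gcd (r - 1).natAbs * q.gcd (s - 1).natAbs = k) (hd : d + k = p * q) (hd0 : d ≠ 0)
    (hc : c * k = p * q) :
    Nat.card (Subgroup.center P) = k ∧ Nonempty (ESCom P ≃g
      graphJoin (completeGr k) (completeGr d ⊕g graphCopies c (completeGr k))) :=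
  TwoExt.nonempty_iso_of_mulEquiv e (card_fixed_diagDatum.trans hk)
    (by rw [hd, Nat.card_prod, Nat.card_zmod, Nat.card_zmod]) hd0
    (by rw [hc, Nat.card_prod, Nat.card_zmod, Nat.card_zmod])

/-! ### The families with a diagonal involution -/

theorem nonempty_dihedral_mulEquiv (n : ℕ) :
    Nonempty (DihedralGroup n ≃* TwoExt (diagDatum n 1 (-1) 1 0
      (by simp) (by simp) (by simp) (by simp))) :=
  ⟨{  toFun g := match g with
        | .r i => .even (i, 0)
        -- `sr i` is `s rⁱ = r⁻ⁱ s`, whereas `odd` puts the abelian part on the left.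
        | .sr i => .odd (-i, 0)
      invFun g := match g with
        | .even x => .r x.1
        | .odd x => .sr (-x.1)
      left_inv := by rintro (i | i) <;> simp
      right_inv := by
        rintro (⟨i, j⟩ | ⟨i, j⟩) <;> simp [Subsingleton.elim j 0]
      map_mul' := by
        rintro (i | i) (j | j) <;> simp [diagDatum_twist, diagDatum_square] <;> abel }⟩

theorem nonempty_quaternion_mulEquiv (n : ℕ) :
    Nonempty (QuaternionGroup n ≃* TwoExt (diagDatum (2 * n) 1 (-1) 1 (n, 0)
      (by simp) (by simp) (by
        have : ((2 * n : ℕ) : ZMod (2 * n)) = 0 := ZMod.natCast_self _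
        push_cast at this ⊢
        linear_combination -this) (by simp))) :=
  ⟨{  toFun g := match g with
        | .a i => .even (i, 0)
        | .xa i => .odd (-i, 0)
      invFun g := match g with
        | .even x => .a x.1
        | .odd x => .xa (-x.1)
      left_inv := by rintro (i | i) <;> simp
      right_inv := by
        rintro (⟨i, j⟩ | ⟨i, j⟩) <;> simp [Subsingleton.elim j 0]
      map_mul' := by
        rintro (i | i) (j | j) <;> simp [diagDatum_twist, diagDatum_square] <;> abel }⟩

theorem PresentedGroup.mk_of {α : Type*} (rels : Set (FreeGroup α)) (x : α) :
    PresentedGroup.mk rels (FreeGroup.of x) = PresentedGroup.of x := rfl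

theorem PresentedGroup.closure_eq_top {rels : Set (FreeGroup (Fin 2))}
    {S : Set (PresentedGroup rels)} (h0 : PresentedGroup.of 0 ∈ S)
    (h1 : PresentedGroup.of 1 ∈ S) : Subgroup.closure S = ⊤ := by
  rw [eq_top_iff, ← PresentedGroup.closure_range_of, Subgroup.closure_le]
  rintro _ ⟨i, rfl⟩
  fin_cases i
  · exact Subgroup.subset_closure h0
  · exact Subgroup.subset_closure h1

/-- The common presentation of the quasidihedral and semidihedral groups. -/
theorem nonempty_metacyclic_mulEquiv (N r : ℕ) (hr : (r * r : ZMod N) = 1) :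
    Nonempty (PresentedGroup ({genA ^ N, genB ^ 2, (genB * genA * genB⁻¹) * (genA ^ r)⁻¹} :
      Set (FreeGroup (Fin 2))) ≃* TwoExt (diagDatum N 1 r 1 0
      (by simpa using hr) (by simp) (by simp) (by simp))) := by
  set rels : Set (FreeGroup (Fin 2)) :=
    {genA ^ N, genB ^ 2, (genB * genA * genB⁻¹) * (genA ^ r)⁻¹}
  have ha := PresentedGroup.one_of_mem (rels := rels) (x := genA ^ N) (by simp [rels])
  have hb := PresentedGroup.one_of_mem (rels := rels) (x := genB ^ 2) (by simp [rels])
  have hab := PresentedGroup.one_of_mem (rels := rels)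
    (x := (genB * genA * genB⁻¹) * (genA ^ r)⁻¹) (by simp [rels])
  simp only [map_mul, map_pow, map_inv, PresentedGroup.mk_of] at ha hb hab
  -- `A = ⟨a⟩` is cyclic, so the second factor is `ZMod 1`, generated by `1`.
  refine TwoExt.nonempty_mulEquiv (u := .of 0) (v := 1) (t := .of 1)
    (PresentedGroup.toGroup (f := ![.even (1, 0), .odd 0]) ?_)
    (PresentedGroup.closure_eq_top (by simp) (by simp)) ?_ ?_ ?_ ha (by simp)
    (Commute.one_right _) r 0 0 1 0 0 ?_ ?_ ?_ ?_ ?_ ?_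
  · rintro x (rfl | rfl | rfl)
    · simp [TwoExt.even_pow, TwoExt.one_def]
    · simp [pow_two, TwoExt.one_def, diagDatum_square]
    · simp [TwoExt.even_pow, TwoExt.one_def, diagDatum_square, diagDatum_twist]
  · simp
  · simp [TwoExt.one_def, Prod.ext_iff, Subsingleton.elim (1 : ZMod 1) 0]
  · simp
  · simp [diagDatum_twist]
  · simp [diagDatum_twist]
  · simp [diagDatum_square, Prod.ext_iff]
  · simpa [mul_inv_eq_one, mul_inv_eq_iff_eq_mul] using hab
  · simp
  · simpa [pow_two] using hb

/-- Here `A = ⟨a²⟩ × ⟨b⟩` and `t = a`, which inverts `b` and has square the first generator. -/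
theorem nonempty_U_mulEquiv (n : ℕ) :
    Nonempty (UGrp n ≃* TwoExt (diagDatum n 3 1 (-1) (1, 0)
      (by simp) (by simp) (by simp) (by simp))) := by
  unfold UGrp
  set rels : Set (FreeGroup (Fin 2)) :=
    {genA ^ (2 * n), genB ^ 3, (genA⁻¹ * genB * genA) * (genB⁻¹)⁻¹}
  have ha := PresentedGroup.one_of_mem (rels := rels) (x := genA ^ (2 * n)) (by simp [rels])
  have hb := PresentedGroup.one_of_mem (rels := rels) (x := genB ^ 3) (by simp [rels])
  have hab := PresentedGroup.one_of_mem (rels := rels)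
    (x := (genA⁻¹ * genB * genA) * (genB⁻¹)⁻¹) (by simp [rels])
  simp only [map_mul, map_pow, map_inv, PresentedGroup.mk_of] at ha hb hab
  refine TwoExt.nonempty_mulEquiv (u := .of 0 ^ 2) (v := .of 1) (t := .of 0)
    (PresentedGroup.toGroup (f := ![.odd 0, .even (0, 1)]) ?_)
    (PresentedGroup.closure_eq_top (by simp) (by simp)) ?_ ?_ ?_ (by rw [← pow_mul, ha]) hb
    ?_ 1 0 0 (-1) 1 0 ?_ ?_ ?_ ?_ ?_ ?_
  · have h3 : (3 : ZMod 3) = 0 := rfl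
    rintro x (rfl | rfl | rfl)
    · simp [pow_mul, pow_two, TwoExt.even_pow, TwoExt.one_def, diagDatum_square]
    · simp [TwoExt.even_pow, TwoExt.one_def, h3]
    · simp [TwoExt.one_def, diagDatum_square, diagDatum_twist]
  · simp [pow_two, diagDatum_square]
  · simp
  · simp
  -- Conjugation by `a` inverts `b`, so `a²` commutes with `b`.
  · rw [mul_inv_eq_one, mul_assoc, inv_mul_eq_iff_eq_mul] at hab
    have h : SemiconjBy (PresentedGroup.of 0) (PresentedGroup.of 1 : PresentedGroup rels)⁻¹
      (PresentedGroup.of 1) := hab.symm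
    have h' := h.mul_left h.inv_right
    rw [inv_inv, ← pow_two] at h'
    exact Commute.inv_right_iff.1 h'.inv_right
  · simp [diagDatum_twist]
  · simp [diagDatum_twist]
  · simp [diagDatum_square]
  · simp [pow_two, mul_assoc]
  · rw [mul_inv_eq_one, mul_assoc, inv_mul_eq_iff_eq_mul] at hab
    simp only [zpow_zero, one_mul, zpow_neg, zpow_one]
    rw [eq_inv_mul_iff_mul_eq, ← mul_assoc, hab, mul_assoc, inv_mul_cancel, mul_one]
  · simp [pow_two]

/-- Here `A = ⟨a⟩ × ⟨b²⟩` and `t = b`, which inverts `a` and has square the second generator. -/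
theorem nonempty_M_mulEquiv (m n : ℕ) :
    Nonempty (MGrp m n ≃* TwoExt (diagDatum m n (-1) 1 (0, 1)
      (by simp) (by simp) (by simp) (by simp))) := by
  unfold MGrp
  set rels : Set (FreeGroup (Fin 2)) :=
    {genA ^ m, genB ^ (2 * n), (genB * genA * genB⁻¹) * (genA⁻¹)⁻¹}
  have ha := PresentedGroup.one_of_mem (rels := rels) (x := genA ^ m) (by simp [rels])
  have hb := PresentedGroup.one_of_mem (rels := rels) (x := genB ^ (2 * n)) (by simp [rels])
  have hab := PresentedGroup.one_of_mem (rels := rels)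
    (x := (genB * genA * genB⁻¹) * (genA⁻¹)⁻¹) (by simp [rels])
  simp only [map_mul, map_pow, map_inv, PresentedGroup.mk_of] at ha hb hab
  rw [mul_inv_eq_one, mul_inv_eq_iff_eq_mul] at hab
  have hcomm : SemiconjBy (PresentedGroup.of 1) (PresentedGroup.of 0)
    (PresentedGroup.of 0 : PresentedGroup rels)⁻¹ := hab
  refine TwoExt.nonempty_mulEquiv (u := .of 0) (v := .of 1 ^ 2) (t := .of 1)
    (PresentedGroup.toGroup (f := ![.even (1, 0), .odd 0]) ?_)
    (PresentedGroup.closure_eq_top (by simp) (by simp)) ?_ ?_ ?_ ha (by rw [← pow_mul, hb])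
    ?_ (-1) 0 0 1 0 1 ?_ ?_ ?_ ?_ ?_ ?_
  · rintro x (rfl | rfl | rfl)
    · simp [TwoExt.even_pow, TwoExt.one_def]
    · simp [pow_mul, pow_two, TwoExt.even_pow, TwoExt.one_def, diagDatum_square]
    · simp [TwoExt.one_def, diagDatum_square, diagDatum_twist]
  · simp
  · simp [pow_two, diagDatum_square]
  · simp
  · have h := hcomm.inv_right.mul_left hcomm
    rw [inv_inv, ← pow_two] at h
    exact Commute.symm h
  · simp [diagDatum_twist]
  · simp [diagDatum_twist]
  · simp [diagDatum_square]
  · simpa using hab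
  · simp [pow_two, mul_assoc]
  · simp [pow_two]

/-! ### The groups `V_{8n}` -/

/-- The involution `(i, j) ↦ (-i, i + j)` of `ZMod (2 * n) × ZMod 2`, with fixed point `(0, 1)`. -/
def shearDatum (n : ℕ) : TwistDatum (ZMod (2 * n) × ZMod 2) where
  twist := AddMonoidHom.prod (-AddMonoidHom.fst _ _)
    ((ZMod.castHom (Dvd.intro n rfl) (ZMod 2)).toAddMonoidHom.comp (AddMonoidHom.fst _ _) +
      AddMonoidHom.snd _ _)
  square := (0, 1)
  twist_twist := by
    rintro ⟨i, j⟩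
    simp [← add_assoc, CharTwo.add_self_eq_zero]
  twist_square := by simp

theorem shearDatum_twist {n : ℕ} (x : ZMod (2 * n) × ZMod 2) :
    (shearDatum n).twist x =
      (-x.1, ZMod.castHom (Dvd.intro n rfl) (ZMod 2) x.1 + x.2) := rfl

theorem shearDatum_square {n : ℕ} : (shearDatum n).square = (0, 1) := rfl

/-- The first coordinate requires `2i = 0` modulo `2n`, the second `i = 0` modulo `2`; `j` is free.
So `i` is `0` for odd `n`, and `0` or `n` for even `n`. -/
theorem mem_fixed_shearDatum_intCast {n : ℕ} (i : ℤ) (j : ZMod 2) :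
    ((i : ZMod (2 * n)), j) ∈ TwoExt.fixed (shearDatum n) ↔ (n : ℤ) ∣ i ∧ 2 ∣ i := by
  rw [TwoExt.mem_fixed, shearDatum_twist, Prod.ext_iff]
  simp only [map_intCast, add_eq_right]
  refine and_congr ?_ (ZMod.intCast_zmod_eq_zero_iff_dvd i 2)
  rw [neg_eq_iff_add_eq_zero, ← two_mul]
  have h := ZMod.intCast_zmod_eq_zero_iff_dvd (2 * i) (2 * n)
  push_cast at h
  rw [h, mul_dvd_mul_iff_left two_ne_zero]

theorem card_fixed_shearDatum_odd {n : ℕ} [NeZero n] (hn : Odd n) :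
    Nat.card (TwoExt.fixed (shearDatum n)) = 2 := by
  have h : Nat.card (TwoExt.fixed (shearDatum n)) =
      Nat.card ({i : ZMod (2 * n) // i = 0} × ZMod 2) := by
    refine Nat.card_congr ((Equiv.subtypeEquivRight fun x => ?_).trans
      (Equiv.prodSubtypeFstEquivSubtypeProd (p := fun i : ZMod (2 * n) => i = 0)))
    obtain ⟨i, j⟩ := x
    obtain ⟨i, rfl⟩ := ZMod.intCast_surjective i
    rw [mem_fixed_shearDatum_intCast, ZMod.intCast_zmod_eq_zero_iff_dvd]
    push_cast
    rw [and_comm]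
    exact ⟨fun h => IsCoprime.mul_dvd
      (Nat.isCoprime_iff_coprime.2 (Nat.coprime_two_left.2 hn)) h.1 h.2,
      fun h => ⟨dvd_of_mul_right_dvd h, dvd_of_mul_left_dvd h⟩⟩
  rw [h]
  simp

theorem card_fixed_shearDatum_even {n : ℕ} [NeZero n] (hn : Even n) :
    Nat.card (TwoExt.fixed (shearDatum n)) = 4 := by
  have h : Nat.card (TwoExt.fixed (shearDatum n)) =
      Nat.card ({i : ZMod (2 * n) // ((2 : ℕ) : ZMod (2 * n)) * i = 0} × ZMod 2) := by
    refine Nat.card_congr ((Equiv.subtypeEquivRight fun x => ?_).trans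
      (Equiv.prodSubtypeFstEquivSubtypeProd
        (p := fun i : ZMod (2 * n) => ((2 : ℕ) : ZMod (2 * n)) * i = 0)))
    obtain ⟨i, j⟩ := x
    obtain ⟨i, rfl⟩ := ZMod.intCast_surjective i
    have h := ZMod.intCast_zmod_eq_zero_iff_dvd (2 * i) (2 * n)
    push_cast at h ⊢
    rw [mem_fixed_shearDatum_intCast, h, mul_dvd_mul_iff_left two_ne_zero, and_iff_left_iff_imp]
    exact fun hi => (Int.natCast_dvd_natCast.2 hn.two_dvd).trans hi
  rw [h, Nat.card_prod, ZMod.card_mul_eq_zero, Nat.card_zmod, Nat.gcd_mul_right_left]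

/-- Here `A = ⟨a⟩ × ⟨b²⟩` and `t = b`, with `b a b⁻¹ = a⁻¹ b²`. -/
theorem nonempty_V_mulEquiv (n : ℕ) : Nonempty (VGrp n ≃* TwoExt (shearDatum n)) := by
  unfold VGrp
  set rels : Set (FreeGroup (Fin 2)) :=
    {genA ^ (2 * n), genB ^ 4, (genB * genA) * (genA⁻¹ * genB⁻¹)⁻¹,
      (genB⁻¹ * genA) * (genA⁻¹ * genB)⁻¹}
  have ha := PresentedGroup.one_of_mem (rels := rels) (x := genA ^ (2 * n)) (by simp [rels])
  have hb := PresentedGroup.one_of_mem (rels := rels) (x := genB ^ 4) (by simp [rels])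
  have hab := PresentedGroup.one_of_mem (rels := rels)
    (x := (genB * genA) * (genA⁻¹ * genB⁻¹)⁻¹) (by simp [rels])
  have hab' := PresentedGroup.one_of_mem (rels := rels)
    (x := (genB⁻¹ * genA) * (genA⁻¹ * genB)⁻¹) (by simp [rels])
  simp only [map_mul, map_pow, map_inv, PresentedGroup.mk_of] at ha hb hab hab'
  rw [mul_inv_eq_one] at hab hab'
  have hb' : (PresentedGroup.of 1 : PresentedGroup rels) ^ 3 = (PresentedGroup.of 1)⁻¹ := by
    rw [eq_inv_iff_mul_eq_one, ← pow_succ, hb]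
  -- The relations give `b a b = a⁻¹ = b⁻¹ a b⁻¹`, hence `a = b² a b²`; then use `b⁴ = 1`.
  have hcomm : Commute (PresentedGroup.of 0 : PresentedGroup rels) (PresentedGroup.of 1 ^ 2) := by
    generalize (PresentedGroup.of 0 : PresentedGroup rels) = a at *
    generalize (PresentedGroup.of 1 : PresentedGroup rels) = b at *
    have h1 : a⁻¹ = b * a * b := by rw [hab, inv_mul_cancel_right]
    have h2 : b⁻¹ * a * b⁻¹ = b * a * b := by rw [hab', mul_inv_cancel_right, h1]
    have h3 : a = b ^ 2 * a * b ^ 2 := by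
      rw [mul_inv_eq_iff_eq_mul, inv_mul_eq_iff_eq_mul] at h2
      rw [pow_two]
      simpa only [mul_assoc] using h2
    have h4 : b ^ 2 * b ^ 2 = 1 := by
      rw [← pow_add, hb]
    calc a * b ^ 2 = b ^ 2 * a * b ^ 2 * b ^ 2 := by rw [← h3]
      _ = b ^ 2 * a := by rw [mul_assoc, h4, mul_one]
  refine TwoExt.nonempty_mulEquiv (u := .of 0) (v := .of 1 ^ 2) (t := .of 1)
    (PresentedGroup.toGroup (f := ![.even (1, 0), .odd 0]) ?_)
    (PresentedGroup.closure_eq_top (by simp) (by simp)) ?_ ?_ ?_ ha (by rw [← pow_mul, hb])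
    hcomm (-1) 1 0 1 0 1 ?_ ?_ ?_ ?_ ?_ ?_
  · rintro x (rfl | rfl | rfl | rfl)
    · simp [TwoExt.even_pow, TwoExt.one_def]
    · simp only [pow_succ (n := 3), pow_succ (n := 2), pow_two]
      simp [TwoExt.one_def, shearDatum_square]
      rfl
    · simp [TwoExt.one_def, shearDatum_square, shearDatum_twist]
      rfl
    · simp [TwoExt.one_def, shearDatum_square, shearDatum_twist]
      rfl
  · simp
  · simp [pow_two, shearDatum_square]
  · simp
  · simp [shearDatum_twist]
  · simp [shearDatum_twist]
  · simp [shearDatum_square]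
  · simp only [zpow_neg, zpow_one, mul_assoc]
    rw [← pow_succ, hb', hab]
  · simp [pow_two, mul_assoc]
  · simp [pow_two]

/-! ### Reordering the join, and gcd computations -/

/-- The two parts of the second factor of a join may be exchanged. -/
theorem nonempty_iso_graphJoin_sumComm {V U W X : Type*} {Γ : SimpleGraph V}
    {G : SimpleGraph U} {H : SimpleGraph W} {K : SimpleGraph X}
    (h : Nonempty (Γ ≃g graphJoin G (H ⊕g K))) : Nonempty (Γ ≃g graphJoin G (K ⊕g H)) :=
  h.map fun e => e.trans (graphJoinCongr SimpleGraph.Iso.refl SimpleGraph.Iso.sumComm)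

theorem gcd_two_pow_pred (m : ℕ) : (2 ^ (m + 3)).gcd (2 ^ (m + 2) - 2) = 2 := by
  have h1 : 2 ^ (m + 2) - 2 = 2 * (2 ^ (m + 1) - 1) := by
    rw [Nat.mul_sub, ← pow_succ']
  rw [h1, pow_succ' 2 (m + 2), Nat.gcd_mul_left]
  have h2 : Nat.Coprime (2 ^ (m + 2)) (2 ^ (m + 1) - 1) := by
    refine Nat.Coprime.pow_left _ (Nat.coprime_two_left.2 ?_)
    refine Nat.Even.sub_odd Nat.one_le_two_pow ?_ odd_one
    exact (Nat.even_pow' (Nat.succ_ne_zero m)).2 even_two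
  rw [h2, mul_one]

theorem gcd_four_mul_of_even {n : ℕ} (hn : Even n) (h1 : 1 ≤ n) :
    (4 * n).gcd (2 * n - 2) = 2 := by
  obtain ⟨n, rfl⟩ : ∃ k, n = k + 1 := ⟨n - 1, by omega⟩
  have h : 2 * (n + 1) - 2 = 2 * n := by omega
  rw [h, show 4 * (n + 1) = 2 * (2 * (n + 1)) by ring, Nat.gcd_mul_left]
  have h2 : Nat.Coprime (2 * (n + 1)) n := by
    refine Nat.Coprime.mul_left (Nat.coprime_two_left.2 ?_) (by simp)
    rwa [Nat.even_add_one, Nat.not_even_iff_odd] at hn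
  rw [h2, mul_one]

theorem gcd_four_mul_of_odd {n : ℕ} (hn : Odd n) : (4 * n).gcd (2 * n - 2) = 4 := by
  obtain ⟨k, rfl⟩ := hn
  have h : 2 * (2 * k + 1) - 2 = 4 * k := by omega
  rw [h, Nat.gcd_mul_left]
  simp

/-! ### The graph of each family -/

theorem dihedral_graph (n : ℕ) (hn : 3 ≤ n) :
    (Odd n →
      Nat.card (Subgroup.center (DihedralGroup n)) = 1 ∧
      Nonempty (ESCom (DihedralGroup n) ≃g
        graphJoin (completeGr 1) (graphCopies n (completeGr 1) ⊕g completeGr (n - 1)))) ∧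
    (Even n →
      Nat.card (Subgroup.center (DihedralGroup n)) = 2 ∧
      Nonempty (ESCom (DihedralGroup n) ≃g
        graphJoin (completeGr 2) (graphCopies (n / 2) (completeGr 2) ⊕g completeGr (n - 2)))) := by
  have : NeZero n := ⟨by omega⟩
  refine ⟨fun h => ?_, fun h => ?_⟩
  · refine (nonempty_iso_diagDatum (nonempty_dihedral_mulEquiv n) ?_ ?_ ?_ ?_).imp_right
      nonempty_iso_graphJoin_sumComm
    · simpa using Nat.coprime_two_right.2 h
    all_goals omega
  · have h2 := Nat.div_mul_cancel h.two_dvd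
    refine (nonempty_iso_diagDatum (nonempty_dihedral_mulEquiv n) ?_ ?_ ?_ ?_).imp_right
      nonempty_iso_graphJoin_sumComm
    · simpa using Nat.gcd_eq_right h.two_dvd
    all_goals omega

theorem quaternion_graph (n : ℕ) (hn : 2 ≤ n) :
    Nat.card (Subgroup.center (QuaternionGroup n)) = 2 ∧
    Nonempty (ESCom (QuaternionGroup n) ≃g
      graphJoin (completeGr 2) (graphCopies n (completeGr 2) ⊕g completeGr (2 * n - 2))) := by
  have : NeZero (2 * n) := ⟨by omega⟩
  refine (nonempty_iso_diagDatum (nonempty_quaternion_mulEquiv n) ?_ ?_ ?_ ?_).imp_right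
    nonempty_iso_graphJoin_sumComm
  · simp
  all_goals omega

theorem quasidihedral_graph (n : ℕ) (hn : 4 ≤ n) :
    Nat.card (Subgroup.center (QuasidihedralGrp n)) = 2 ∧
    Nonempty (ESCom (QuasidihedralGrp n) ≃g
      graphJoin (completeGr 2)
        (completeGr (2 ^ (n - 1) - 2) ⊕g graphCopies (2 ^ (n - 2)) (completeGr 2))) := by
  obtain ⟨m, rfl⟩ : ∃ m, n = m + 4 := ⟨n - 4, by omega⟩
  have h1 : 1 ≤ 2 ^ (m + 2) := Nat.one_le_two_pow
  have h2 : 4 ≤ 2 ^ (m + 2) := Nat.pow_le_pow_right two_pos (by omega : 2 ≤ m + 2)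
  have h3 : 2 ^ (m + 3) = 2 * 2 ^ (m + 2) := pow_succ' _ _
  have hr : ((2 ^ (m + 2) - 1 : ℕ) * (2 ^ (m + 2) - 1 : ℕ) : ZMod (2 ^ (m + 3))) = 1 := by
    have h := ZMod.natCast_self (2 ^ (m + 3))
    push_cast [h1] at h ⊢
    -- `(2^(m+2) - 1)² - 1 = (2^(m+1) - 1) * 2^(m+3)`.
    linear_combination (2 ^ (m + 1) - 1) * h
  refine nonempty_iso_diagDatum (nonempty_metacyclic_mulEquiv (2 ^ (m + 3)) _ hr)
    (d := 2 ^ (m + 3) - 2) (c := 2 ^ (m + 2)) ?_ ?_ ?_ ?_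
  · rw [show ((2 ^ (m + 2) - 1 : ℕ) - 1 : ℤ).natAbs = 2 ^ (m + 2) - 2 by omega, gcd_two_pow_pred]
    simp
  all_goals omega

theorem V_graph (n : ℕ) (hn : 1 ≤ n) :
    (Odd n →
      Nat.card (Subgroup.center (VGrp n)) = 2 ∧
      Nonempty (ESCom (VGrp n) ≃g
        graphJoin (completeGr 2)
          (completeGr (4 * n - 2) ⊕g graphCopies (2 * n) (completeGr 2)))) ∧
    (Even n →
      Nat.card (Subgroup.center (VGrp n)) = 4 ∧
      Nonempty (ESCom (VGrp n) ≃g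
        graphJoin (completeGr 4)
          (completeGr (4 * n - 4) ⊕g graphCopies n (completeGr 4)))) := by
  have : NeZero n := ⟨by omega⟩
  have hcard : Nat.card (ZMod (2 * n) × ZMod 2) = 2 * n * 2 := by
    rw [Nat.card_prod, Nat.card_zmod, Nat.card_zmod]
  refine ⟨fun h => ?_, fun h => ?_⟩
  · refine TwoExt.nonempty_iso_of_mulEquiv (nonempty_V_mulEquiv n)
      (card_fixed_shearDatum_odd h) ?_ ?_ ?_ <;> omega
  -- Evenness excludes `n = 1`, where `4n - 4` would vanish.
  · obtain ⟨k, rfl⟩ := h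
    refine TwoExt.nonempty_iso_of_mulEquiv (nonempty_V_mulEquiv _)
      (card_fixed_shearDatum_even ⟨k, rfl⟩) ?_ ?_ ?_ <;> omega

theorem semidihedral_graph (n : ℕ) (hn : 2 ≤ n) :
    (Odd n →
      Nat.card (Subgroup.center (SemidihedralGrp n)) = 4 ∧
      Nonempty (ESCom (SemidihedralGrp n) ≃g
        graphJoin (completeGr 4)
          (completeGr (4 * n - 4) ⊕g graphCopies n (completeGr 4)))) ∧
    (Even n →
      Nat.card (Subgroup.center (SemidihedralGrp n)) = 2 ∧
      Nonempty (ESCom (SemidihedralGrp n) ≃g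
        graphJoin (completeGr 2)
          (completeGr (4 * n - 2) ⊕g graphCopies (2 * n) (completeGr 2)))) := by
  have : NeZero (4 * n) := ⟨by omega⟩
  have h1 : 1 ≤ 2 * n := by omega
  have hr : ((2 * n - 1 : ℕ) * (2 * n - 1 : ℕ) : ZMod (4 * n)) = 1 := by
    have h : ((4 * n : ℕ) : ZMod (4 * n)) = 0 := ZMod.natCast_self _
    push_cast [h1] at h ⊢
    -- `(2n - 1)² - 1 = (n - 1) * 4n`.
    linear_combination (n - 1) * h
  have hg : ((2 * n - 1 : ℕ) - 1 : ℤ).natAbs = 2 * n - 2 := by omega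
  refine ⟨fun h => ?_, fun h => ?_⟩ <;>
    refine nonempty_iso_diagDatum (nonempty_metacyclic_mulEquiv (4 * n) _ hr) ?_ ?_ ?_ ?_
  · rw [hg, gcd_four_mul_of_odd h]
    simp
  on_goal 4 =>
    rw [hg, gcd_four_mul_of_even h (by omega)]
    simp
  all_goals omega

theorem U_graph (n : ℕ) (hn : 1 ≤ n) :
    Nat.card (Subgroup.center (UGrp n)) = n ∧
    Nonempty (ESCom (UGrp n) ≃g
      graphJoin (completeGr n) (completeGr (2 * n) ⊕g graphCopies 3 (completeGr n))) := by
  have : NeZero n := ⟨by omega⟩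
  refine nonempty_iso_diagDatum (nonempty_U_mulEquiv n) ?_ ?_ ?_ ?_
  · simp
  all_goals omega

/-- The involution inverts `a` and fixes `b²`, so `k = gcd(m, 2) * gcd(n, 0) = gcd(m, 2) * n`. -/
theorem M_graph (m n : ℕ) (hm : 3 ≤ m) (hn : 1 ≤ n) :
    (Odd m →
      Nat.card (Subgroup.center (MGrp m n)) = n ∧
      Nonempty (ESCom (MGrp m n) ≃g
        graphJoin (completeGr n)
          (completeGr ((m - 1) * n) ⊕g graphCopies m (completeGr n)))) ∧
    (Even m →
      Nat.card (Subgroup.center (MGrp m n)) = 2 * n ∧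
      Nonempty (ESCom (MGrp m n) ≃g
        graphJoin (completeGr (2 * n))
          (completeGr ((m / 2 - 1) * (2 * n)) ⊕g
            graphCopies (m / 2) (completeGr (2 * n))))) := by
  have : NeZero m := ⟨by omega⟩
  have : NeZero n := ⟨by omega⟩
  refine ⟨fun h => ?_, fun h => ?_⟩
  · refine nonempty_iso_diagDatum (nonempty_M_mulEquiv m n) ?_ ?_ ?_ rfl
    · have h2 : m.gcd 2 = 1 := Nat.coprime_two_right.2 h
      simp [h2]
    · obtain ⟨m, rfl⟩ : ∃ k, m = k + 1 := ⟨m - 1, by omega⟩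
      rw [Nat.add_sub_cancel]
      ring
    · exact mul_ne_zero (by omega) (by omega)
  · obtain ⟨k, rfl⟩ := h.two_dvd
    rw [Nat.mul_div_cancel_left k two_pos]
    refine nonempty_iso_diagDatum (nonempty_M_mulEquiv (2 * k) n) ?_ ?_ ?_ (by ring)
    · simp
    · obtain ⟨m, rfl⟩ : ∃ l, k = l + 1 := ⟨k - 1, by omega⟩
      rw [Nat.add_sub_cancel]
      ring
    · exact mul_ne_zero (by omega) (by omega)

theorem mainTheorem7 :
    -- dihedral groups of order `2n`
    (∀ n : ℕ, 3 ≤ n →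
      (Odd n →
        Nat.card (Subgroup.center (DihedralGroup n)) = 1 ∧
        Nonempty (ESCom (DihedralGroup n) ≃g
          graphJoin (completeGr 1) (graphCopies n (completeGr 1) ⊕g completeGr (n - 1)))) ∧
      (Even n →
        Nat.card (Subgroup.center (DihedralGroup n)) = 2 ∧
        Nonempty (ESCom (DihedralGroup n) ≃g
          graphJoin (completeGr 2) (graphCopies (n / 2) (completeGr 2) ⊕g completeGr (n - 2))))) ∧
    -- generalized quaternion (dicyclic) groups of order `4n`
    (∀ n : ℕ, 2 ≤ n →
      Nat.card (Subgroup.center (QuaternionGroup n)) = 2 ∧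
      Nonempty (ESCom (QuaternionGroup n) ≃g
        graphJoin (completeGr 2) (graphCopies n (completeGr 2) ⊕g completeGr (2 * n - 2)))) ∧
    -- quasidihedral groups of order `2^n`
    (∀ n : ℕ, 4 ≤ n →
      Nat.card (Subgroup.center (QuasidihedralGrp n)) = 2 ∧
      Nonempty (ESCom (QuasidihedralGrp n) ≃g
        graphJoin (completeGr 2)
          (completeGr (2 ^ (n - 1) - 2) ⊕g graphCopies (2 ^ (n - 2)) (completeGr 2)))) ∧
    -- the groups `V_{8n}`
    (∀ n : ℕ, 1 ≤ n →
      (Odd n →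
        Nat.card (Subgroup.center (VGrp n)) = 2 ∧
        Nonempty (ESCom (VGrp n) ≃g
          graphJoin (completeGr 2)
            (completeGr (4 * n - 2) ⊕g graphCopies (2 * n) (completeGr 2)))) ∧
      (Even n →
        Nat.card (Subgroup.center (VGrp n)) = 4 ∧
        Nonempty (ESCom (VGrp n) ≃g
          graphJoin (completeGr 4)
            (completeGr (4 * n - 4) ⊕g graphCopies n (completeGr 4))))) ∧
    -- semidihedral groups of order `8n`
    (∀ n : ℕ, 2 ≤ n →
      (Odd n →
        Nat.card (Subgroup.center (SemidihedralGrp n)) = 4 ∧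
        Nonempty (ESCom (SemidihedralGrp n) ≃g
          graphJoin (completeGr 4)
            (completeGr (4 * n - 4) ⊕g graphCopies n (completeGr 4)))) ∧
      (Even n →
        Nat.card (Subgroup.center (SemidihedralGrp n)) = 2 ∧
        Nonempty (ESCom (SemidihedralGrp n) ≃g
          graphJoin (completeGr 2)
            (completeGr (4 * n - 2) ⊕g graphCopies (2 * n) (completeGr 2))))) ∧
    -- the groups `U_{6n}`
    (∀ n : ℕ, 1 ≤ n →
      Nat.card (Subgroup.center (UGrp n)) = n ∧
      Nonempty (ESCom (UGrp n) ≃g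
        graphJoin (completeGr n) (completeGr (2 * n) ⊕g graphCopies 3 (completeGr n)))) ∧
    -- the groups `M_{2mn}`
    (∀ m n : ℕ, 3 ≤ m → m ≠ 4 → 1 ≤ n →
      (Odd m →
        Nat.card (Subgroup.center (MGrp m n)) = n ∧
        Nonempty (ESCom (MGrp m n) ≃g
          graphJoin (completeGr n)
            (completeGr ((m - 1) * n) ⊕g graphCopies m (completeGr n)))) ∧
      (Even m →
        Nat.card (Subgroup.center (MGrp m n)) = 2 * n ∧
        Nonempty (ESCom (MGrp m n) ≃g
          graphJoin (completeGr (2 * n))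
            (completeGr ((m / 2 - 1) * (2 * n)) ⊕g
              graphCopies (m / 2) (completeGr (2 * n)))))) := by
  exact ⟨dihedral_graph, quaternion_graph, quasidihedral_graph, V_graph, semidihedral_graph,
    U_graph, fun m n hm _ hn => M_graph m n hm hn⟩
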